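/- For a real matrix $A$ with singular values $\sigma_1(A)\ge\sigma_2(A)\ge\cdots$ and $p\ge 1$, let $\|A\|_p=\bigl(\sum_{i=1}^{\operatorname{rank}A}\sigma_i(A)^p\bigr)^{1/p}$ denote its Schatten $p$-norm. The following two statements hold. (i) There is an absolute constant $D_0>0$ such that for all real numbers $p>2$ and $1\le q<p$ there are constants $C,c>0$, depending only on $p$ and $q$, with the following property. For every integer $n\ge 1$ and every real $D\ge D_0$ there is a finite set $T\subset\mathbb R^{n\times n}$ with $|T|\le C\,n\ln(Dn)$ such that, for every integer $t\ge 0$ and every matrix $R\in\mathbb R^{t\times n}$ (which may depend on $T$), if $$\|A\|_p\le\|RA\|_q\le D^{\frac12-\frac1p}\|A\|_p\qquad\text{for all }A\in T,$$ then $t\ge c\,n/D$. (ii) There is an absolute constant $\kappa\in(0,1)$ such that for all real numbers $p>2$ and $1\le q<p$ there are constants $C,c>0$ and $k\in\mathbb N$, depending only on $p$ and $q$, with the following property. For every integer $n\ge1$ there is a finite set $T\subset\mathbb R^{n\times n}$ with $|T|\le C\,n^k$ such that, for every integer $1\le t\le\kappa n$, every matrix $R\in\mathbb R^{t\times n}$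 (which may depend on $T$) and every real number $D_{p,q}$, if $$\|A\|_p\le\|RA\|_q\le D_{p,q}\|A\|_p\qquad\text{for all }A\in T,$$ then $D_{p,q}\ge c\,(n/t)^{\frac12-\frac1p}$. -/

import Mathlib

/-- The Schatten `p`-norm `(∑_{i=1}^{rank A} σ_i(A)^p)^{1/p}` of a real matrix, where
`σ_1(A) ≥ σ_2(A) ≥ …` are its singular values (the square roots of the eigenvalues of `AᵀA`;
Mathlib numbers them from `0`). -/
noncomputable def schattenNorm {m n : ℕ} (p : ℝ) (A : Matrix (Fin m) (Fin n) ℝ) : ℝ :=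
  (∑ i ∈ Finset.range A.rank, (Matrix.toEuclideanLin A).singularValues i ^ p) ^ (1 / p)

/-- Left multiplication by the sketching matrix `R`, as a map from the Schatten `p`-norm to the
Schatten `q`-norm, has distortion at most `δ` on every matrix of the set `T`:
`‖A‖_p ≤ ‖RA‖_q ≤ δ ‖A‖_p`. -/
def SketchesWithDistortion {t n : ℕ} (p q δ : ℝ) (T : Finset (Matrix (Fin n) (Fin n) ℝ))
    (R : Matrix (Fin t) (Fin n) ℝ) : Prop :=
  ∀ A ∈ T, schattenNorm p A ≤ schattenNorm q (R * A) ∧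
    schattenNorm q (R * A) ≤ δ * schattenNorm p A

/-!
One family of test matrices serves both parts: the `n` matrix units in the first column together
with the identity, so `n + 1` matrices in all, and the constant `c` can be taken to be `1`.

A matrix of rank at most one has all its Schatten norms equal to its Frobenius norm, so the lower
bound on the matrix units says that every column of `R` has Euclidean length at least `1`, that is,
`n ≤ ‖R‖_F²`. The upper bound on the identity says `‖R‖_q ≤ δ n^{1/p}`. But `R` has rank at most
`t`, and Schatten norms decrease in the exponent, so that Hölder's inequality gives
`‖R‖_F ≤ t^{1/2-1/p} ‖R‖_p ≤ t^{1/2-1/p} ‖R‖_q` (`sum_sq_singularValues_rpow_le`,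
`schattenNorm_anti`). Combining the three yields `(n/t)^{1/2-1/p} ≤ δ`
(`SketchesWithDistortion.rpow_le`), which is the second part; with `δ = D^{1/2-1/p}` it reads
`n / D ≤ t`, which is the first.
-/

theorem schattenNorm_nonneg {m n : ℕ} (p : ℝ) (A : Matrix (Fin m) (Fin n) ℝ) :
    0 ≤ schattenNorm p A :=
  Real.rpow_nonneg (Finset.sum_nonneg fun i _ =>
    Real.rpow_nonneg (LinearMap.singularValues_nonneg _ i) _) _

theorem schattenNorm_rpow {m n : ℕ} {p : ℝ} (hp : 0 < p) (A : Matrix (Fin m) (Fin n) ℝ) :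
    schattenNorm p A ^ p =
      ∑ i ∈ Finset.range A.rank, (Matrix.toEuclideanLin A).singularValues i ^ p := by
  rw [schattenNorm, ← Real.rpow_mul (Finset.sum_nonneg fun i _ =>
    Real.rpow_nonneg (LinearMap.singularValues_nonneg _ i) _), one_div_mul_cancel hp.ne',
    Real.rpow_one]

theorem schattenNorm_anti {m n : ℕ} {p q : ℝ} (hq : 0 < q) (hqp : q ≤ p)
    (A : Matrix (Fin m) (Fin n) ℝ) : schattenNorm p A ≤ schattenNorm q A := by
  set σ := (Matrix.toEuclideanLin A).singularValues with hσ
  have hσ0 : ∀ i, 0 ≤ σ i := LinearMap.singularValues_nonneg _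
  set N := schattenNorm q A with hN
  have hN0 : 0 ≤ N := schattenNorm_nonneg q A
  have hp : 0 < p := hq.trans_le hqp
  have hsum : ∑ i ∈ Finset.range A.rank, σ i ^ q = N ^ q := (schattenNorm_rpow hq A).symm
  have hle : ∀ i ∈ Finset.range A.rank, σ i ≤ N := fun i hi => by
    rw [← Real.rpow_le_rpow_iff (hσ0 i) hN0 hq, ← hsum]
    exact Finset.single_le_sum (f := fun i => σ i ^ q)
      (fun j _ => Real.rpow_nonneg (hσ0 j) _) hi
  rw [← Real.rpow_le_rpow_iff (schattenNorm_nonneg p A) hN0 hp, schattenNorm_rpow hp]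
  calc ∑ i ∈ Finset.range A.rank, σ i ^ p
      = ∑ i ∈ Finset.range A.rank, σ i ^ q * σ i ^ (p - q) :=
        Finset.sum_congr rfl fun i _ => by
          rw [← Real.rpow_add_of_nonneg (hσ0 i) hq.le (sub_nonneg.2 hqp), add_sub_cancel]
    _ ≤ ∑ i ∈ Finset.range A.rank, σ i ^ q * N ^ (p - q) :=
        Finset.sum_le_sum fun i hi => mul_le_mul_of_nonneg_left
          (Real.rpow_le_rpow (hσ0 i) (hle i hi) (sub_nonneg.2 hqp)) (Real.rpow_nonneg (hσ0 i) _)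
    _ = N ^ p := by
        rw [← Finset.sum_mul, hsum, ← Real.rpow_add_of_nonneg hN0 hq.le (sub_nonneg.2 hqp),
          add_sub_cancel]

/-- Hölder's inequality between the Frobenius norm and a Schatten norm with larger exponent. -/
theorem sum_sq_singularValues_rpow_le {m n : ℕ} {p : ℝ} (hp : 2 ≤ p)
    (A : Matrix (Fin m) (Fin n) ℝ) :
    (∑ i ∈ Finset.range A.rank, (Matrix.toEuclideanLin A).singularValues i ^ 2) ^ (p / 2) ≤
      (A.rank : ℝ) ^ (p / 2 - 1) * schattenNorm p A ^ p := by
  have h := Real.rpow_sum_le_const_mul_sum_rpow_of_nonneg (s := Finset.range A.rank)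
    (f := fun i => (Matrix.toEuclideanLin A).singularValues i ^ 2) (p := p / 2)
    (by linarith) (fun i _ => sq_nonneg _)
  rw [schattenNorm_rpow (by linarith)]
  convert! h using 2
  · simp
  · refine Finset.sum_congr rfl fun i _ => ?_
    rw [← Real.rpow_natCast, ← Real.rpow_mul (LinearMap.singularValues_nonneg _ i)]
    congr 1
    push_cast
    ring

/-- The squared Frobenius norm is the sum of the squared singular values: both are the trace of
`AᵀA`. -/
theorem sum_sq_singularValues_eq {m n : ℕ} (A : Matrix (Fin m) (Fin n) ℝ) :
    ∑ i ∈ Finset.range A.rank, (Matrix.toEuclideanLin A).singularValues i ^ 2 =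
      ∑ j, ∑ i, A i j ^ 2 := by
  set T := Matrix.toEuclideanLin A with hT
  have hrank : A.rank = Module.finrank ℝ T.range := by
    rw [hT, Matrix.toEuclideanLin, Matrix.toLpLin_eq_toLin]
    exact A.rank_eq_finrank_range_toLin _ _
  have hn : Module.finrank ℝ (EuclideanSpace ℝ (Fin n)) = n := finrank_euclideanSpace_fin
  have htr := T.isSymmetric_adjoint_comp_self.trace_eq_sum_eigenvalues hn
  rw [LinearMap.trace_eq_sum_inner _ (EuclideanSpace.basisFun (Fin n) ℝ)] at htr
  have hext : ∑ i ∈ Finset.range A.rank, T.singularValues i ^ 2 =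
      ∑ i ∈ Finset.range n, T.singularValues i ^ 2 := by
    refine Finset.sum_subset (Finset.range_mono A.rank_le_width) fun i _ hi => ?_
    rw [Finset.mem_range, not_lt, hrank] at hi
    simp [T.singularValues_eq_zero_iff_le_finrank_range.2 hi]
  rw [hext, ← Fin.sum_univ_eq_sum_range (fun i => T.singularValues i ^ 2) n]
  simp_rw [T.sq_singularValues_fin hn]
  refine htr.symm.trans (Finset.sum_congr rfl fun j _ => ?_)
  rw [LinearMap.comp_apply, LinearMap.adjoint_inner_right, real_inner_self_eq_norm_sq,
    EuclideanSpace.norm_sq_eq]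
  refine Finset.sum_congr rfl fun i _ => ?_
  simp [hT, Matrix.toEuclideanLin, Matrix.toLpLin_apply]

theorem schattenNorm_of_rank_le_one {m n : ℕ} {p : ℝ} (hp : 0 < p)
    {A : Matrix (Fin m) (Fin n) ℝ} (hA : A.rank ≤ 1) :
    schattenNorm p A = √(∑ j, ∑ i, A i j ^ 2) := by
  rw [← sum_sq_singularValues_eq, schattenNorm]
  interval_cases A.rank
  · simp [hp.ne']
  · have h := LinearMap.singularValues_nonneg (Matrix.toEuclideanLin A) 0
    rw [Finset.sum_range_one, Finset.sum_range_one, Real.sqrt_sq h, ← Real.rpow_mul h,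
      mul_one_div_cancel hp.ne', Real.rpow_one]

theorem rank_single_one_le_one {m n : ℕ} (i : Fin m) (j : Fin n) :
    (Matrix.single i j (1 : ℝ)).rank ≤ 1 := by
  rw [Matrix.single_eq_single_vecMulVec_single]
  exact Matrix.rank_vecMulVec_le _ _

theorem schattenNorm_single_one {n : ℕ} {p : ℝ} (hp : 0 < p) (i j : Fin n) :
    schattenNorm p (Matrix.single i j (1 : ℝ)) = 1 := by
  rw [schattenNorm_of_rank_le_one hp (rank_single_one_le_one i j),
    Finset.sum_eq_single j (fun k _ hk => by simp [hk.symm]) (by simp)]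
  simp [Matrix.single_apply]

theorem schattenNorm_mul_single_one {t n : ℕ} {q : ℝ} (hq : 0 < q)
    (R : Matrix (Fin t) (Fin n) ℝ) (i j : Fin n) :
    schattenNorm q (R * Matrix.single i j (1 : ℝ)) = √(∑ k, R k i ^ 2) := by
  rw [schattenNorm_of_rank_le_one hq ((Matrix.rank_mul_le_right _ _).trans
      (rank_single_one_le_one i j)),
    Finset.sum_eq_single j (fun k _ hk => by simp [hk]) (by simp)]
  simp

theorem schattenNorm_one_le {n : ℕ} {p : ℝ} (hp : 0 < p) :
    schattenNorm p (1 : Matrix (Fin n) (Fin n) ℝ) ≤ (n : ℝ) ^ (1 / p) := by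
  refine Real.rpow_le_rpow (Finset.sum_nonneg fun i _ =>
    Real.rpow_nonneg (LinearMap.singularValues_nonneg _ i) _) ?_ (by positivity)
  rw [Matrix.rank_one, Fintype.card_fin]
  refine (Finset.sum_le_card_nsmul _ _ 1 fun i hi => ?_).trans (by simp)
  have hi' : i < Module.finrank ℝ (EuclideanSpace ℝ (Fin n)) := by simpa using hi
  obtain ⟨v, hv⟩ := (LinearMap.hasEigenvalue_adjoint_comp_self_sq_singularValues
    (Matrix.toEuclideanLin (1 : Matrix (Fin n) (Fin n) ℝ)) hi').exists_hasEigenvector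
  have hT : Matrix.toEuclideanLin (1 : Matrix (Fin n) (Fin n) ℝ) = LinearMap.id := by
    ext v i
    simp [Matrix.toEuclideanLin]
  have hadj : LinearMap.adjoint (LinearMap.id : EuclideanSpace ℝ (Fin n) →ₗ[ℝ] _) =
      LinearMap.id := LinearMap.adjoint_id
  have h1 := hv.apply_eq_smul
  rw [hT] at h1 ⊢
  rw [hadj, LinearMap.comp_id, LinearMap.id_apply] at h1
  have h2 : (LinearMap.id : EuclideanSpace ℝ (Fin n) →ₗ[ℝ] _).singularValues i ^ 2 = 1 :=
    smul_left_injective ℝ hv.2 (by simpa using h1.symm)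
  have h3 := (pow_eq_one_iff_of_nonneg (LinearMap.singularValues_nonneg
    (LinearMap.id : EuclideanSpace ℝ (Fin n) →ₗ[ℝ] _) i) two_ne_zero).1 h2
  rw [h3, Real.one_rpow]

open Classical in
/-- The matrix units in the `j`-th column, together with the identity. -/
noncomputable def columnUnitsAndOne {n : ℕ} (j : Fin n) : Finset (Matrix (Fin n) (Fin n) ℝ) :=
  insert 1 (Finset.univ.image fun i => Matrix.single i j 1)

theorem card_columnUnitsAndOne_le {n : ℕ} (j : Fin n) : (columnUnitsAndOne j).card ≤ n + 1 :=
  (Finset.card_insert_le _ _).trans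
    (Nat.succ_le_succ (Finset.card_image_le.trans (Finset.card_fin n).le))

namespace SketchesWithDistortion

variable {t n : ℕ} {p q δ : ℝ} {j : Fin n} {R : Matrix (Fin t) (Fin n) ℝ}

theorem one_le_sum_sq_column (hp : 0 < p) (hq : 0 < q)
    (h : SketchesWithDistortion p q δ (columnUnitsAndOne j) R) (i : Fin n) :
    1 ≤ ∑ k, R k i ^ 2 := by
  have h1 := (h (Matrix.single i j 1) (by simp [columnUnitsAndOne])).1
  rwa [schattenNorm_single_one hp, schattenNorm_mul_single_one hq, Real.one_le_sqrt] at h1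

theorem rows_pos (hp : 0 < p) (hq : 0 < q)
    (h : SketchesWithDistortion p q δ (columnUnitsAndOne j) R) : 0 < t := by
  rcases Nat.eq_zero_or_pos t with rfl | ht
  · have := h.one_le_sum_sq_column hp hq j
    norm_num at this
  · exact ht

/-- Any sketch of the test family with `t` rows has distortion at least `(n/t)^{1/2-1/p}`. -/
theorem rpow_le (hp : 2 < p) (hq : 1 ≤ q) (hqp : q < p)
    (h : SketchesWithDistortion p q δ (columnUnitsAndOne j) R) :
    ((n : ℝ) / t) ^ (1 / 2 - 1 / p) ≤ δ := by
  have hp0 : 0 < p := by linarith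
  have hq0 : 0 < q := by linarith
  have ht : (0 : ℝ) < t := Nat.cast_pos.2 (h.rows_pos hp0 hq0)
  have hn : (0 : ℝ) < n := Nat.cast_pos.2 j.pos
  have hδ : 0 ≤ δ := by
    have h1 := h (Matrix.single j j 1) (by simp [columnUnitsAndOne])
    rw [schattenNorm_single_one hp0, mul_one] at h1
    linarith [h1.1.trans h1.2]
  have hI : schattenNorm q R ≤ δ * (n : ℝ) ^ (1 / p) := by
    have h1 := (h 1 (by simp [columnUnitsAndOne])).2
    rw [Matrix.mul_one] at h1
    exact h1.trans (mul_le_mul_of_nonneg_left (schattenNorm_one_le hp0) hδ)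
  have hF : (n : ℝ) ≤
      ∑ i ∈ Finset.range R.rank, (Matrix.toEuclideanLin R).singularValues i ^ 2 := by
    rw [sum_sq_singularValues_eq]
    calc (n : ℝ) = ∑ _i : Fin n, (1 : ℝ) := by simp
      _ ≤ _ := Finset.sum_le_sum fun i _ => h.one_le_sum_sq_column hp0 hq0 i
  have hkey : (n : ℝ) ^ (p / 2) ≤ (t : ℝ) ^ (p / 2 - 1) * (δ ^ p * n) :=
    calc (n : ℝ) ^ (p / 2) ≤ (R.rank : ℝ) ^ (p / 2 - 1) * schattenNorm p R ^ p :=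
          (Real.rpow_le_rpow hn.le hF (by positivity)).trans
            (sum_sq_singularValues_rpow_le hp.le R)
      _ ≤ (t : ℝ) ^ (p / 2 - 1) * (δ * (n : ℝ) ^ (1 / p)) ^ p := by
          have := schattenNorm_nonneg p R
          refine mul_le_mul ?_ ?_ (by positivity) (by positivity)
          · exact Real.rpow_le_rpow (Nat.cast_nonneg _) (Nat.cast_le.2 R.rank_le_height)
              (by linarith)
          · exact Real.rpow_le_rpow this ((schattenNorm_anti hq0 hqp.le R).trans hI) hp0.le
      _ = (t : ℝ) ^ (p / 2 - 1) * (δ ^ p * n) := by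
          rw [Real.mul_rpow hδ (by positivity), ← Real.rpow_mul hn.le,
            one_div_mul_cancel hp0.ne', Real.rpow_one]
  rw [← Real.rpow_le_rpow_iff (by positivity) hδ hp0, ← Real.rpow_mul (by positivity),
    show (1 / 2 - 1 / p) * p = p / 2 - 1 by field_simp, Real.div_rpow hn.le ht.le,
    div_le_iff₀ (by positivity)]
  rw [show p / 2 = p / 2 - 1 + 1 by ring, Real.rpow_add_one hn.ne', add_sub_cancel_right,
    ← mul_assoc] at hkey
  exact (le_of_mul_le_mul_right hkey hn).trans_eq (mul_comm _ _)

end SketchesWithDistortion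

theorem mainTheorem3 :
    (∃ D₀ : ℝ, 0 < D₀ ∧ ∀ p q : ℝ, 2 < p → 1 ≤ q → q < p →
      ∃ C c : ℝ, 0 < C ∧ 0 < c ∧
        ∀ n : ℕ, 0 < n → ∀ D : ℝ, D₀ ≤ D →
          ∃ T : Finset (Matrix (Fin n) (Fin n) ℝ),
            (T.card : ℝ) ≤ C * (n * Real.log (D * n)) ∧
            ∀ (t : ℕ) (R : Matrix (Fin t) (Fin n) ℝ),
              SketchesWithDistortion p q (D ^ (1 / 2 - 1 / p)) T R →
                c * (n / D) ≤ t) ∧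
    (∃ κ : ℝ, 0 < κ ∧ κ < 1 ∧ ∀ p q : ℝ, 2 < p → 1 ≤ q → q < p →
      ∃ (C c : ℝ) (k : ℕ), 0 < C ∧ 0 < c ∧
        ∀ n : ℕ, 0 < n →
          ∃ T : Finset (Matrix (Fin n) (Fin n) ℝ),
            (T.card : ℝ) ≤ C * (n : ℝ) ^ k ∧
            ∀ (t : ℕ) (R : Matrix (Fin t) (Fin n) ℝ) (δ : ℝ),
              0 < t → (t : ℝ) ≤ κ * n →
              SketchesWithDistortion p q δ T R →
                c * ((n : ℝ) / t) ^ (1 / 2 - 1 / p) ≤ δ) := by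
  have hcard : ∀ (n : ℕ) (hn : 0 < n),
      ((columnUnitsAndOne (⟨0, hn⟩ : Fin n)).card : ℝ) ≤ 2 * n := fun n hn => by
    have h : (columnUnitsAndOne (⟨0, hn⟩ : Fin n)).card ≤ 2 * n :=
      (card_columnUnitsAndOne_le _).trans (by omega)
    exact_mod_cast h
  constructor
  · refine ⟨Real.exp 1, Real.exp_pos 1, fun p q hp hq hqp => ⟨2, 1, two_pos, one_pos,
      fun n hn D hD => ⟨columnUnitsAndOne ⟨0, hn⟩, ?_, fun t R h => ?_⟩⟩⟩
    · have hn1 : (1 : ℝ) ≤ n := by exact_mod_cast hn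
      have hD0 : 0 < D := (Real.exp_pos 1).trans_le hD
      -- `D₀ = e` makes the logarithm at least `1`, so that `n + 1 ≤ 2 n` matrices are few enough.
      have hlog : 1 ≤ Real.log (D * n) := by
        rw [Real.le_log_iff_exp_le (by positivity)]
        exact hD.trans (le_mul_of_one_le_right hD0.le hn1)
      exact (hcard n hn).trans
        (mul_le_mul_of_nonneg_left (le_mul_of_one_le_right (by positivity) hlog) two_pos.le)
    · have hD0 : 0 < D := (Real.exp_pos 1).trans_le hD
      have ht : (0 : ℝ) < t := Nat.cast_pos.2 (h.rows_pos (by linarith) (by linarith))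
      have ha : 0 < 1 / 2 - 1 / p := sub_pos.2 (one_div_lt_one_div_of_lt two_pos hp)
      have hle := (Real.rpow_le_rpow_iff (by positivity) hD0.le ha).1 (h.rpow_le hp hq hqp)
      rw [one_mul, div_le_iff₀ hD0]
      rwa [div_le_iff₀ ht, mul_comm] at hle
  · refine ⟨1 / 2, by norm_num, by norm_num, fun p q hp hq hqp => ⟨2, 1, 1, two_pos, one_pos,
      fun n hn => ⟨columnUnitsAndOne ⟨0, hn⟩, ?_, fun t R δ _ _ h => ?_⟩⟩⟩
    · rw [pow_one]
      exact hcard n hn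
    · rw [one_mul]
      exact h.rpow_le hp hq hqp
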